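/- Fix a countably infinite set $\mathcal V$ of variables and let $\mathfrak S_f(\mathcal V)$ be the group of permutations of $\mathcal V$ moving only finitely many elements. A nominal set is a set with an action of $\mathfrak S_f(\mathcal V)$ in which every element $x$ is supported by some finite $S\subseteq\mathcal V$ (every $\pi\in\mathfrak S_f(\mathcal V)$ fixing $S$ pointwise fixes $x$); $\mathsf{Nom}$ is the category of nominal sets and equivariant maps. Let $L:\mathsf{Nom}\to\mathsf{Nom}$ be the functor $LX=\mathcal V+\mathcal V\times X+X\times X$. The rational fixpoint $\varrho L$ is the colimit, in the category of all $L$-coalgebras, of the inclusion of the full subcategory of all $L$-coalgebras whose carrier is a finitely presentable object of $\mathsf{Nom}$. A $\lambda$-tree is a finite or infinite rooted ordered tree whose leaves are labelled by variables and whose inner nodes are either labelled by $\lambda x$ with $x\in\mathcal V$ and have one successor, or labelled by $@$ and have two successors. Trees are considered up to isomorphism, but not up to $\alpha$-equivalence, and $\mathfrak S_f(\mathcal V)$ acts on them by renaming all (free and bound) variables. A $\lambda$-tree is rational if it has only finitely many subtrees (up to isomorphism). **Proposition.** The rational fixpoint of $L$ is formed by all rational $\lambda$-trees. That is, the set of all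 rational $\lambda$-trees is a nominal set, and with the structure map that decomposes a tree at its root it is the rational fixpoint $\varrho L$. Moreover, the $\lambda$-trees in which only finitely many (free and bound) variables occur form, with decomposition at the root, the final $L$-coalgebra $\nu L$, and the unique coalgebra homomorphism $\varrho L\to\nu L$ is injective with image exactly the set of all rational $\lambda$-trees. -/

import Mathlib

open CategoryTheory CategoryTheory.Limits

universe v u

section RationalFixpoint

variable {C : Type u} [Category.{v} C]

/-- The coalgebras for `F` whose carrier is a finitely presentable object. -/
def fpCarrier (F : C ⥤ C) : ObjectProperty (Endofunctor.Coalgebra F) :=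
  fun A => IsFinitelyPresentable.{v} A.V

/-- `R` is a rational fixpoint of `F`: it is a colimit of the inclusion, into the category of all
`F`-coalgebras, of the full subcategory of those with finitely presentable carrier. -/
def IsRationalFixpoint (F : C ⥤ C) (R : Endofunctor.Coalgebra F) : Prop :=
  ∃ τ : (fpCarrier F).ι ⟶ (Functor.const (fpCarrier F).FullSubcategory).obj R,
    Nonempty (IsColimit (Cocone.mk R τ))

end RationalFixpoint

section NominalSets

/-- The group of finite permutations of `V`, i.e. those that move only finitely many elements. -/
def FinPerm (V : Type u) : Subgroup (Equiv.Perm V) where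
  carrier := {π | {v | π v ≠ v}.Finite}
  one_mem' := by simp
  mul_mem' := by
    intro a b ha hb
    refine Set.Finite.subset (Set.Finite.union ha hb) ?_
    intro v hv
    by_contra h
    have h1 : a v = v := by_contra fun h' => h (Or.inl h')
    have h2 : b v = v := by_contra fun h' => h (Or.inr h')
    exact hv (by rw [Equiv.Perm.mul_apply, h2, h1])
  inv_mem' := by
    intro a ha
    refine Set.Finite.subset ha ?_
    intro v hv h
    exact hv (by rw [Equiv.Perm.inv_eq_iff_eq, h])

/-- A nominal set over the set of names `V`: a set with an action of the finite permutations
of `V` in which every element has a finite support. -/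
structure Nom (V : Type u) where
  carrier : Type u
  [action : MulAction (FinPerm V) carrier]
  finite_support : ∀ x : carrier, ∃ S : Set V, S.Finite ∧ MulAction.Supports (FinPerm V) S x

attribute [instance] Nom.action

/-- Equivariant maps. -/
@[ext]
structure Nom.Hom {V : Type u} (X Y : Nom V) where
  toFun : X.carrier → Y.carrier
  equivariant : ∀ (π : FinPerm V) (x : X.carrier), toFun (π • x) = π • toFun x

instance Nom.category (V : Type u) : Category.{u} (Nom V) where
  Hom X Y := Nom.Hom X Y
  id X := ⟨fun x => x, fun _ _ => rfl⟩
  comp f g := ⟨fun x => g.toFun (f.toFun x), fun π x => by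
    rw [f.equivariant, g.equivariant]⟩

/-- The functor `L X = V + V × X + X × X` on nominal sets (with the componentwise action). -/
def lamFunctor (V : Type u) : Nom V ⥤ Nom V where
  obj X :=
    { carrier := V ⊕ (V × X.carrier) ⊕ (X.carrier × X.carrier)
      finite_support := by
        rintro (v | ⟨v, x⟩ | ⟨x, y⟩)
        · refine ⟨{v}, Set.finite_singleton v, fun π h => ?_⟩
          exact congrArg Sum.inl (h rfl)
        · obtain ⟨S, hS, hx⟩ := X.finite_support x
          refine ⟨insert v S, hS.insert v, fun π h => ?_⟩
          exact congrArg (Sum.inr ∘ Sum.inl) (Prod.ext (h (Set.mem_insert _ _))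
            (hx π fun a ha => h (Set.mem_insert_of_mem _ ha)))
        · obtain ⟨S, hS, hx⟩ := X.finite_support x
          obtain ⟨T, hT, hy⟩ := X.finite_support y
          refine ⟨S ∪ T, hS.union hT, fun π h => ?_⟩
          exact congrArg (Sum.inr ∘ Sum.inr) (Prod.ext (hx π fun a ha => h (Or.inl ha))
            (hy π fun a ha => h (Or.inr ha))) }
  map f :=
    { toFun := Sum.map id (Sum.map (Prod.map id f.toFun) (Prod.map f.toFun f.toFun))
      equivariant := by
        rintro π (v | ⟨v, x⟩ | ⟨x, y⟩)
        · rfl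
        · exact congrArg (Sum.inr ∘ Sum.inl) (Prod.ext rfl (f.equivariant π x))
        · exact congrArg (Sum.inr ∘ Sum.inr)
            (Prod.ext (f.equivariant π x) (f.equivariant π y)) }
  map_id X := by
    apply Nom.Hom.ext
    funext x
    rcases x with v | ⟨v, x⟩ | ⟨x, y⟩ <;> rfl
  map_comp f g := by
    apply Nom.Hom.ext
    funext x
    rcases x with v | ⟨v, x⟩ | ⟨x, y⟩ <;> rfl

end NominalSets

section LambdaTrees

/-- Node labels: a variable (leaf), `λ x` (one successor), or `@` (two successors). -/
inductive Label (V : Type u) : Type u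
  | var (x : V)
  | lam (x : V)
  | app

/-- The number of successors of a node with the given label. -/
def Label.arity {V : Type u} : Label V → ℕ
  | var _ => 0
  | lam _ => 1
  | app => 2

/-- The variable that occurs in a label, if any. -/
def Label.name {V : Type u} : Label V → Option V
  | var x => some x
  | lam x => some x
  | app => none

/-- Renaming of the variable in a label. -/
def Label.rename {V : Type u} (π : FinPerm V) : Label V → Label V
  | var x => var (π • x)
  | lam x => lam (π • x)
  | app => app

/-- A (finite or infinite) `λ`-tree, given by its partial labelling of positions. A position is
the list of successor indices on the path from the root; `label p = none` means that there is no
node at `p`. -/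
@[ext]
structure LambdaTree (V : Type u) where
  label : List (Fin 2) → Option (Label V)
  root_isSome : (label []).isSome
  isSome_child : ∀ (p : List (Fin 2)) (i : Fin 2),
    (label (p ++ [i])).isSome ↔ ∃ l, label p = some l ∧ (i : ℕ) < l.arity

namespace LambdaTree

variable {V : Type u}

/-- The subtree rooted at the node at position `p`. -/
def subtree (t : LambdaTree V) (p : List (Fin 2)) (hp : (t.label p).isSome) : LambdaTree V where
  label q := t.label (p ++ q)
  root_isSome := by simpa using hp
  isSome_child q i := by rw [← List.append_assoc]; exact t.isSome_child (p ++ q) i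

/-- The set of all subtrees of a tree. As trees are given by their labelling of positions,
isomorphic subtrees are equal. -/
def subtrees (t : LambdaTree V) : Set (LambdaTree V) :=
  {s | ∃ (p : List (Fin 2)) (hp : (t.label p).isSome), s = t.subtree p hp}

/-- A tree is rational if it has only finitely many subtrees. -/
def IsRational (t : LambdaTree V) : Prop := t.subtrees.Finite

/-- The set of all variables (free or bound) that occur in a tree. -/
def vars (t : LambdaTree V) : Set V :=
  {x | ∃ p l, t.label p = some l ∧ l.name = some x}

/-- A tree in which only finitely many variables (free or bound) occur. -/
def HasFiniteVars (t : LambdaTree V) : Prop := t.vars.Finite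

theorem rename_isSome_child (π : FinPerm V) (t : LambdaTree V) (p : List (Fin 2)) (i : Fin 2) :
    ((t.label (p ++ [i])).map (Label.rename π)).isSome ↔
      ∃ l, (t.label p).map (Label.rename π) = some l ∧ (i : ℕ) < l.arity := by
  rw [Option.isSome_map, t.isSome_child]
  constructor
  · rintro ⟨l, h, hi⟩
    refine ⟨l.rename π, by rw [h]; rfl, ?_⟩
    cases l <;> exact hi
  · rintro ⟨l, h, hi⟩
    obtain ⟨l', h', rfl⟩ := Option.map_eq_some_iff.1 h
    refine ⟨l', h', ?_⟩
    cases l' <;> exact hi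

/-- Finite permutations act on trees by renaming all variables, free and bound. -/
instance : MulAction (FinPerm V) (LambdaTree V) where
  smul π t :=
    { label := fun p => (t.label p).map (Label.rename π)
      root_isSome := by rw [Option.isSome_map]; exact t.root_isSome
      isSome_child := rename_isSome_child π t }
  one_smul t := by
    apply LambdaTree.ext
    funext p
    change (t.label p).map (Label.rename 1) = t.label p
    rcases t.label p with _ | (x | x | _) <;> simp [Label.rename]
  mul_smul π σ t := by
    apply LambdaTree.ext
    funext p
    change (t.label p).map (Label.rename (π * σ)) =
      ((t.label p).map (Label.rename σ)).map (Label.rename π)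
    rcases t.label p with _ | (x | x | _) <;> simp [Label.rename, mul_smul]

theorem smul_label (π : FinPerm V) (t : LambdaTree V) (p : List (Fin 2)) :
    (π • t).label p = (t.label p).map (Label.rename π) := rfl

theorem supports_vars (t : LambdaTree V) : MulAction.Supports (FinPerm V) t.vars t := by
  intro π h
  apply LambdaTree.ext
  funext p
  rw [smul_label]
  rcases hl : t.label p with _ | (x | x | _)
  · rfl
  · have := h (a := x) ⟨p, _, hl, rfl⟩
    simp [Label.rename, this]
  · have := h (a := x) ⟨p, _, hl, rfl⟩
    simp [Label.rename, this]
  · rfl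

theorem isSome_smul {π : FinPerm V} {t : LambdaTree V} {p : List (Fin 2)} :
    ((π • t).label p).isSome ↔ (t.label p).isSome := by
  rw [smul_label, Option.isSome_map]

theorem smul_subtree (π : FinPerm V) (t : LambdaTree V) (p : List (Fin 2))
    (hp : (t.label p).isSome) :
    π • t.subtree p hp = (π • t).subtree p (isSome_smul.2 hp) := rfl

theorem subtrees_subtree (t : LambdaTree V) (p : List (Fin 2)) (hp : (t.label p).isSome) :
    (t.subtree p hp).subtrees ⊆ t.subtrees := by
  rintro s ⟨q, hq, rfl⟩
  refine ⟨p ++ q, hq, LambdaTree.ext ?_⟩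
  funext r
  exact congrArg t.label (List.append_assoc p q r).symm

theorem vars_subtree (t : LambdaTree V) (p : List (Fin 2)) (hp : (t.label p).isSome) :
    (t.subtree p hp).vars ⊆ t.vars := by
  rintro x ⟨q, l, h, hx⟩
  exact ⟨p ++ q, l, h, hx⟩

theorem IsRational.subtree {t : LambdaTree V} (h : t.IsRational) (p : List (Fin 2))
    (hp : (t.label p).isSome) : (t.subtree p hp).IsRational :=
  Set.Finite.subset h (t.subtrees_subtree p hp)

theorem HasFiniteVars.subtree {t : LambdaTree V} (h : t.HasFiniteVars) (p : List (Fin 2))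
    (hp : (t.label p).isSome) : (t.subtree p hp).HasFiniteVars :=
  Set.Finite.subset h (t.vars_subtree p hp)

theorem IsRational.smul {t : LambdaTree V} (h : t.IsRational) (π : FinPerm V) :
    (π • t).IsRational := by
  refine Set.Finite.subset (Set.Finite.image (fun s => π • s) h) ?_
  rintro s ⟨p, hp, rfl⟩
  exact ⟨_, ⟨p, isSome_smul.1 hp, rfl⟩, rfl⟩

theorem HasFiniteVars.smul {t : LambdaTree V} (h : t.HasFiniteVars) (π : FinPerm V) :
    (π • t).HasFiniteVars := by
  refine Set.Finite.subset (Set.Finite.image (fun x => π • x) h) ?_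
  rintro x ⟨p, l, hl, hx⟩
  obtain ⟨l', hl', rfl⟩ := Option.map_eq_some_iff.1 hl
  rcases l' with y | y | _
  · exact ⟨y, ⟨p, _, hl', rfl⟩, by simpa [Label.rename, Label.name] using hx⟩
  · exact ⟨y, ⟨p, _, hl', rfl⟩, by simpa [Label.rename, Label.name] using hx⟩
  · simp [Label.rename, Label.name] at hx

theorem IsRational.hasFiniteVars {t : LambdaTree V} (h : t.IsRational) : t.HasFiniteVars := by
  refine Set.Finite.subset (Set.Finite.biUnion h
    (t := fun s => {x | (s.label []).bind Label.name = some x}) ?_) ?_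
  · intro s _
    apply Set.Subsingleton.finite
    intro x hx y hy
    exact Option.some.inj (hx.symm.trans hy)
  · rintro x ⟨p, l, hl, hx⟩
    have hp : (t.label p).isSome := by rw [hl]; rfl
    refine Set.mem_biUnion (x := t.subtree p hp) ⟨p, hp, rfl⟩ ?_
    change (t.label (p ++ [])).bind Label.name = some x
    rw [List.append_nil, hl]
    exact hx

theorem isSome_succ {t : LambdaTree V} {l : Label V} (h : t.label [] = some l) (i : Fin 2)
    (hi : (i : ℕ) < l.arity) : (t.label [i]).isSome :=
  (t.isSome_child [] i).2 ⟨l, h, hi⟩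

/-- Decomposition of a tree at the root: a single node is sent to its variable, a tree with
root `λ x` to `x` and the tree below, and a tree with root `@` to its two immediate subtrees.
Here `P` is a property of trees that is inherited by subtrees. -/
def decompose (P : LambdaTree V → Prop)
    (hP : ∀ t, P t → ∀ (p : List (Fin 2)) (hp : (t.label p).isSome), P (t.subtree p hp))
    (t : {t : LambdaTree V // P t}) :
    V ⊕ (V × {t : LambdaTree V // P t}) ⊕
      ({t : LambdaTree V // P t} × {t : LambdaTree V // P t}) :=
  match h : t.1.label [] with
  | some (.var x) => .inl x
  | some (.lam x) =>
      .inr (.inl (x, ⟨_, hP t.1 t.2 [0] (isSome_succ h 0 (by simp [Label.arity]))⟩))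
  | some .app =>
      .inr (.inr (⟨_, hP t.1 t.2 [0] (isSome_succ h 0 (by simp [Label.arity]))⟩,
        ⟨_, hP t.1 t.2 [1] (isSome_succ h 1 (by simp [Label.arity]))⟩))
  | none => absurd t.1.root_isSome (by simp [h])

section

variable {P : LambdaTree V → Prop}
  (hP : ∀ t, P t → ∀ (p : List (Fin 2)) (hp : (t.label p).isSome), P (t.subtree p hp))
  (t : {t : LambdaTree V // P t})

theorem decompose_var {x : V} (h : t.1.label [] = some (.var x)) :
    decompose P hP t = .inl x := by
  unfold decompose
  split <;> rename_i h' <;> cases h'.symm.trans h <;> rfl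

theorem decompose_lam {x : V} (h : t.1.label [] = some (.lam x)) :
    decompose P hP t = .inr (.inl (x, ⟨t.1.subtree [0] (isSome_succ h 0 (by simp [Label.arity])),
      hP t.1 t.2 [0] _⟩)) := by
  unfold decompose
  split <;> rename_i h' <;> cases h'.symm.trans h <;> rfl

theorem decompose_app (h : t.1.label [] = some .app) :
    decompose P hP t = .inr (.inr
      (⟨t.1.subtree [0] (isSome_succ h 0 (by simp [Label.arity])), hP t.1 t.2 [0] _⟩,
        ⟨t.1.subtree [1] (isSome_succ h 1 (by simp [Label.arity])), hP t.1 t.2 [1] _⟩)) := by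
  unfold decompose
  split <;> rename_i h' <;> cases h'.symm.trans h <;> rfl

end

end LambdaTree

open LambdaTree

/-- The nominal set of all trees satisfying a property `P` that is invariant under renaming and
implies that only finitely many variables occur. -/
def treeNom {V : Type u} (P : LambdaTree V → Prop) (hπ : ∀ t, P t → ∀ π : FinPerm V, P (π • t))
    (hfin : ∀ t, P t → t.HasFiniteVars) : Nom V :=
  letI act : MulAction (FinPerm V) {t : LambdaTree V // P t} :=
    { smul := fun π t => ⟨π • t.1, hπ t.1 t.2 π⟩
      one_smul := fun t => Subtype.ext (one_smul _ t.1)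
      mul_smul := fun π σ t => Subtype.ext (mul_smul π σ t.1) }
  { carrier := {t : LambdaTree V // P t}
    action := act
    finite_support := fun t =>
      ⟨t.1.vars, hfin t.1 t.2, fun π h => Subtype.ext (t.1.supports_vars π h)⟩ }

/-- The `L`-coalgebra of all trees satisfying a property `P` that is inherited by subtrees,
invariant under renaming, and implies that only finitely many variables occur; its structure map
is the decomposition at the root. -/
def treeCoalgebra {V : Type u} (P : LambdaTree V → Prop)
    (hP : ∀ t, P t → ∀ (p : List (Fin 2)) (hp : (t.label p).isSome), P (t.subtree p hp))
    (hπ : ∀ t, P t → ∀ π : FinPerm V, P (π • t))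
    (hfin : ∀ t, P t → t.HasFiniteVars) : Endofunctor.Coalgebra (lamFunctor V) where
  V := treeNom P hπ hfin
  str :=
    { toFun := decompose P hP
      equivariant := by
        intro π t
        obtain ⟨l, hl⟩ := Option.isSome_iff_exists.1 t.1.root_isSome
        have hl' : (π • t.1).label [] = some (l.rename π) := by rw [smul_label, hl]; rfl
        rcases l with x | x | _
        · rw [decompose_var hP t hl]
          exact decompose_var hP ⟨π • t.1, hπ t.1 t.2 π⟩ hl'
        · rw [decompose_lam hP t hl]
          exact decompose_lam hP ⟨π • t.1, hπ t.1 t.2 π⟩ hl'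
        · rw [decompose_app hP t hl]
          exact decompose_app hP ⟨π • t.1, hπ t.1 t.2 π⟩ hl' }

/-- The coalgebra of all trees in which only finitely many variables occur. -/
def finVarsCoalgebra (V : Type u) : Endofunctor.Coalgebra (lamFunctor V) :=
  treeCoalgebra HasFiniteVars (fun _ h => h.subtree) (fun _ h => h.smul) (fun _ h => h)

/-- The coalgebra of all rational trees. -/
def rationalCoalgebra (V : Type u) : Endofunctor.Coalgebra (lamFunctor V) :=
  treeCoalgebra IsRational (fun _ h => h.subtree) (fun _ h => h.smul) (fun _ h => h.hasFiniteVars)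

end LambdaTrees

/-! Finitely presentable nominal sets are the orbit-finite ones, and everything rests on unfolding a
state of an `L`-coalgebra into the tree of its root labels. By equivariance of the structure map, a
finite set `S` supporting a state also supports its successors, and (as `V` is infinite) contains
the variable in its root label. Hence every unfolding has only finitely many variables. Unfolding is
a homomorphism, and the only one into a coalgebra of trees (`coe_hom_treeCoalgebra`), which gives
finality. In an orbit-finite set only finitely many elements are supported by `S`
(`IsOrbitFinite.finite_supported`), so states of orbit-finite coalgebras unfold to rational trees.
Conversely, a rational tree is a state of the orbit-finite coalgebra of renamings of its subtrees,
so a cocone has a forced value at each rational tree. This value agrees with every leg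
(`legTree_unfold`) because a state and its unfolding have the same image in the orbit-finite
coalgebra of all unfoldings. The finiteness input is `Nom.exists_finite_transversal`: up to
permutations fixing `S`, a translate of `x` depends only on which names of a support of `x` are sent
to which names of `S`. -/

/-! ### Extending and correcting finite permutations. -/

section FinitePermutations

variable {V : Type u}

/-- An injection defined on a finite set extends to a finite permutation. -/
theorem FinPerm.exists_extending {A : Set V} (hA : A.Finite) {f : V → V} (hf : A.InjOn f) :
    ∃ σ : FinPerm V, ∀ a ∈ A, σ • a = f a := by
  classical
  -- Inside the finite set `A ∪ f '' A`, the bijection from `A` to `f '' A` extends to a permutation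
  -- by counting complements. Outside it, the identity is used.
  let W : Finset V := (hA.union (hA.image f)).toFinset
  have hW : ∀ x, x ∈ W ↔ x ∈ A ∪ f '' A := fun x => by simp [W]
  let e : {x : W // x.1 ∈ A} ≃ {x : W // x.1 ∈ f '' A} :=
    Equiv.ofBijective
      (fun x => ⟨⟨f x.1.1, (hW _).2 (Or.inr ⟨_, x.2, rfl⟩)⟩, ⟨_, x.2, rfl⟩⟩)
      ⟨fun x y h => Subtype.ext (Subtype.ext (hf x.2 y.2 (congrArg (fun z => (z.1.1 : V)) h))), by
        rintro ⟨⟨y, hy⟩, hyA⟩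
        obtain ⟨x, hx, hxy⟩ := hyA
        exact ⟨⟨⟨x, (hW _).2 (Or.inl hx)⟩, hx⟩, Subtype.ext (Subtype.ext hxy)⟩⟩
  refine ⟨⟨Equiv.Perm.ofSubtype e.extendSubtype, ?_⟩, ?_⟩
  · refine W.finite_toSet.subset fun v hv => ?_
    by_contra h
    exact hv (Equiv.Perm.ofSubtype_apply_of_not_mem _ h)
  · intro a ha
    have haW : a ∈ W := (hW a).2 (Or.inl ha)
    change Equiv.Perm.ofSubtype e.extendSubtype a = f a
    rw [Equiv.Perm.ofSubtype_apply_of_mem _ haW, e.extendSubtype_apply_of_mem ⟨a, haW⟩ ha]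
    rfl

/-- If two finite permutations restrict to the same partial map from `T` to `S`, then they differ
on `T` by a finite permutation that fixes `S`. -/
theorem FinPerm.exists_fixing {S T : Set V} (hS : S.Finite) (hT : T.Finite) {π ρ : FinPerm V}
    (h : ∀ a ∈ T, ∀ b ∈ S, π • a = b ↔ ρ • a = b) :
    ∃ σ : FinPerm V, (∀ b ∈ S, σ • b = b) ∧ ∀ a ∈ T, σ • π • a = ρ • a := by
  classical
  -- The prescribed map is the identity on `S` and `ρ π⁻¹` on `π • T`. The hypothesis makes the two
  -- agree on the overlap and keeps the union injective.
  obtain ⟨σ, hσ⟩ := FinPerm.exists_extending (A := S ∪ (fun a => π • a) '' T)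
    (f := fun x => if x ∈ S then x else ρ • π⁻¹ • x) (hS.union (hT.image _)) (by
      rintro x hx y hy hxy
      by_cases hxS : x ∈ S <;> by_cases hyS : y ∈ S
      · simpa [hxS, hyS] using hxy
      · obtain ⟨a, ha, rfl⟩ := hy.resolve_left hyS
        simp only [hxS, hyS, if_true, if_false, inv_smul_smul] at hxy
        exact ((h a ha x hxS).2 hxy.symm).symm
      · obtain ⟨a, ha, rfl⟩ := hx.resolve_left hxS
        simp only [hxS, hyS, if_true, if_false, inv_smul_smul] at hxy
        exact (h a ha y hyS).2 hxy
      · simpa [hxS, hyS] using hxy)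
  refine ⟨σ, fun b hb => ?_, fun a ha => ?_⟩
  · rw [hσ b (Or.inl hb), if_pos hb]
  · rw [hσ _ (Or.inr ⟨a, ha, rfl⟩)]
    split_ifs with hS'
    · exact ((h a ha _ hS').1 rfl).symm
    · rw [inv_smul_smul]

/-- If `v ∉ S`, swapping `v` with a fresh name outside `S` fixes `S` but moves `v`. -/
theorem supports_variable_iff [Infinite V] {S : Set V} (hS : S.Finite) {v : V} :
    MulAction.Supports (FinPerm V) S v ↔ v ∈ S := by
  classical
  refine ⟨fun h => ?_, fun hv π h => h hv⟩
  by_contra hv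
  obtain ⟨w, hw⟩ := (hS.insert v).exists_notMem
  have hwS : w ∉ S := fun h' => hw (Or.inr h')
  have hmem : Equiv.swap v w ∈ FinPerm V := by
    refine (Set.toFinite {v, w}).subset fun x hx => ?_
    by_contra h'
    simp only [Set.mem_insert_iff, Set.mem_singleton_iff, not_or] at h'
    exact hx (Equiv.swap_apply_of_ne_of_ne h'.1 h'.2)
  have := h ⟨Equiv.swap v w, hmem⟩ fun a ha =>
    Equiv.swap_apply_of_ne_of_ne (fun e => hv (e ▸ ha)) (fun e => hwS (e ▸ ha))
  have h2 : Equiv.swap v w v = v := this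
  rw [Equiv.swap_apply_left] at h2
  exact hw (Or.inl h2)

end FinitePermutations

/-! ### Orbit-finite nominal sets. -/

namespace Nom

variable {V : Type u}

/-- Finitely many translates of `x` by elements of `P` represent all others up to permutations
that fix the finite set `S`. -/
theorem exists_finite_transversal (X : Nom V) (x : X.carrier) {S : Set V} (hS : S.Finite)
    (P : Set (FinPerm V)) :
    ∃ N ⊆ P, N.Finite ∧ ∀ ρ ∈ P, ∃ π ∈ N, ∃ σ : FinPerm V,
      (∀ b ∈ S, σ • b = b) ∧ σ • π • x = ρ • x := by
  obtain ⟨T, hT, hx⟩ := X.finite_support x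
  have := hS.to_subtype
  have := hT.to_subtype
  -- `key π` is the graph of the partial map from `T` to `S` induced by `π`. There are finitely many
  -- such graphs, and `N` takes one permutation for each that occurs in `P`.
  let key : FinPerm V → Set (T × S) := fun π => {p | π • p.1.1 = p.2.1}
  obtain ⟨N, hNP, hN⟩ := Set.exists_subset_bijOn P key
  refine ⟨N, hNP, hN.finite_iff_finite.2 (Set.toFinite _), fun ρ hρ => ?_⟩
  obtain ⟨π, hπ, hkey⟩ := hN.surjOn ⟨ρ, hρ, rfl⟩
  obtain ⟨σ, hσ, hσT⟩ := FinPerm.exists_fixing hS hT (π := π) (ρ := ρ) fun a ha b hb =>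
    Set.ext_iff.1 hkey (⟨a, ha⟩, ⟨b, hb⟩)
  refine ⟨π, hπ, σ, hσ, ?_⟩
  -- Since `σ π` and `ρ` agree on the support `T` of `x`, the permutation `ρ⁻¹ σ π` fixes `x`.
  have h := hx (ρ⁻¹ * (σ * π)) fun a ha => by
    rw [mul_smul, mul_smul, hσT a ha, inv_smul_smul]
  rw [mul_smul, mul_smul, inv_smul_eq_iff] at h
  exact h

/-- A nominal set with finitely many orbits. -/
def IsOrbitFinite (X : Nom V) : Prop :=
  ∃ F : Set X.carrier, F.Finite ∧ ∀ y, ∃ x ∈ F, ∃ π : FinPerm V, π • x = y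

/-- Within one orbit, each translate is carried to one of finitely many by a permutation fixing `S`.
If the translate is supported by `S`, such a permutation does not move it, so it is one of these. -/
theorem IsOrbitFinite.finite_supported {X : Nom V} (hX : X.IsOrbitFinite) {S : Set V}
    (hS : S.Finite) : {y : X.carrier | MulAction.Supports (FinPerm V) S y}.Finite := by
  obtain ⟨F, hF, hcover⟩ := hX
  choose N _ hNfin hN using fun x => X.exists_finite_transversal x hS Set.univ
  refine (hF.biUnion fun x _ => (hNfin x).image fun π => π • x).subset fun y hy => ?_
  obtain ⟨x, hx, ρ, rfl⟩ := hcover y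
  obtain ⟨π, hπ, σ, hσ, h⟩ := hN x ρ (Set.mem_univ _)
  refine Set.mem_biUnion hx ⟨π, hπ, ?_⟩
  have hy' : σ⁻¹ • ρ • x = ρ • x := hy σ⁻¹ fun b hb => inv_smul_eq_iff.2 (hσ b hb).symm
  exact (eq_inv_smul_iff.2 h).trans hy'

theorem IsOrbitFinite.of_surjective {X Y : Nom V} (hX : X.IsOrbitFinite) (f : X ⟶ Y)
    (hf : Function.Surjective f.toFun) : Y.IsOrbitFinite := by
  obtain ⟨F, hF, hcover⟩ := hX
  refine ⟨f.toFun '' F, hF.image _, fun y => ?_⟩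
  obtain ⟨x, rfl⟩ := hf y
  obtain ⟨z, hz, π, rfl⟩ := hcover x
  exact ⟨_, ⟨z, hz, rfl⟩, π, (f.equivariant π z).symm⟩

@[simp] theorem comp_toFun {X Y Z : Nom V} (f : X ⟶ Y) (g : Y ⟶ Z) (x : X.carrier) :
    (f ≫ g).toFun x = g.toFun (f.toFun x) := rfl

@[simp] theorem id_toFun {X : Nom V} (x : X.carrier) :
    Nom.Hom.toFun (𝟙 X) x = x := rfl

theorem hom_ext {X Y : Nom V} {f g : X ⟶ Y} (h : ∀ x, f.toFun x = g.toFun x) : f = g :=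
  Nom.Hom.ext (funext h)

theorem congr_toFun {X Y : Nom V} {f g : X ⟶ Y} (h : f = g) (x : X.carrier) :
    f.toFun x = g.toFun x := by rw [h]

/-! ### Elements of filtered colimits of nominal sets. -/

section FilteredColimits

variable {J : Type u} [SmallCategory J] (D : J ⥤ Nom V)

@[simp] theorem map_comp_toFun {i j k : J} (f : i ⟶ j) (g : j ⟶ k) (x : (D.obj i).carrier) :
    (D.map (f ≫ g)).toFun x = (D.map g).toFun ((D.map f).toFun x) := by
  rw [D.map_comp, comp_toFun]

@[simp] theorem map_id_toFun {i : J} (x : (D.obj i).carrier) :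
    (D.map (𝟙 i)).toFun x = x := by
  rw [D.map_id, id_toFun]

theorem cocone_w_toFun {D : J ⥤ Nom V} (c : Cocone D) {i j : J} (f : i ⟶ j)
    (x : (D.obj i).carrier) :
    (c.ι.app j).toFun ((D.map f).toFun x) = (c.ι.app i).toFun x :=
  congr_toFun (c.w f) x

variable [IsFiltered J]

/-- Two elements of a filtered diagram are identified when they agree at some later stage. -/
def filteredSetoid : Setoid (Σ j, (D.obj j).carrier) where
  r p q := ∃ (k : J) (f : p.1 ⟶ k) (g : q.1 ⟶ k), (D.map f).toFun p.2 = (D.map g).toFun q.2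
  iseqv :=
    { refl := fun p => ⟨p.1, 𝟙 _, 𝟙 _, rfl⟩
      symm := fun ⟨k, f, g, h⟩ => ⟨k, g, f, h.symm⟩
      trans := by
        rintro p q r ⟨k, f, g, h⟩ ⟨l, f', g', h'⟩
        obtain ⟨m, a, b, hab⟩ := IsFiltered.span g f'
        refine ⟨m, f ≫ a, g' ≫ b, ?_⟩
        rw [map_comp_toFun, h, ← map_comp_toFun, hab, map_comp_toFun, h', ← map_comp_toFun] }

/-- The filtered colimit of nominal sets, as a quotient of the disjoint union. -/
def filteredColimit : Nom V where
  carrier := Quotient (filteredSetoid D)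
  action :=
    { smul := fun π => Quotient.map (fun p => ⟨p.1, π • p.2⟩) (by
        rintro p q ⟨k, f, g, h⟩
        refine ⟨k, f, g, ?_⟩
        change (D.map f).toFun (π • p.2) = (D.map g).toFun (π • q.2)
        rw [(D.map f).equivariant, (D.map g).equivariant, h])
      one_smul := by
        rintro ⟨j, x⟩
        exact congrArg (fun y => (Quotient.mk (filteredSetoid D) ⟨j, y⟩)) (one_smul _ x)
      mul_smul := by
        rintro π σ ⟨j, x⟩
        exact congrArg (fun y => (Quotient.mk (filteredSetoid D) ⟨j, y⟩)) (mul_smul π σ x) }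
  finite_support := by
    rintro ⟨j, x⟩
    obtain ⟨S, hS, hx⟩ := (D.obj j).finite_support x
    exact ⟨S, hS, fun π h =>
      congrArg (fun y => (Quotient.mk (filteredSetoid D) ⟨j, y⟩)) (hx π h)⟩

/-- The cocone on the filtered colimit. -/
def filteredCocone : Cocone D where
  pt := filteredColimit D
  ι :=
    { app := fun j =>
        { toFun := fun x => Quotient.mk (filteredSetoid D) ⟨j, x⟩
          equivariant := fun _ _ => rfl }
      naturality := by
        intro i j f
        refine hom_ext fun x => Quotient.sound ⟨j, 𝟙 j, f, ?_⟩
        exact map_id_toFun D _ }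

/-- The comparison map out of the filtered colimit. -/
def filteredDesc {D : J ⥤ Nom V} (c : Cocone D) : (filteredCocone D).pt ⟶ c.pt where
  toFun := Quotient.lift (fun p => (c.ι.app p.1).toFun p.2) (by
    rintro p q ⟨k, f, g, h⟩
    change (c.ι.app p.1).toFun p.2 = (c.ι.app q.1).toFun q.2
    rw [← cocone_w_toFun c f, h, cocone_w_toFun])
  equivariant := by
    rintro π ⟨j, x⟩
    exact (c.ι.app j).equivariant π x

variable {D} {c : Cocone D} (hc : IsColimit c)
include hc

/-- The composite from `c.pt` to the explicit quotient and back is the identity by uniqueness, so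
representatives in the quotient suffice. The quotient need not itself be shown to be a colimit. -/
theorem exists_rep_of_isColimit (x : c.pt.carrier) :
    ∃ (j : J) (y : (D.obj j).carrier), (c.ι.app j).toFun y = x := by
  have h : hc.desc (filteredCocone D) ≫ filteredDesc c = 𝟙 c.pt := by
    refine hc.hom_ext fun j => ?_
    rw [← Category.assoc, hc.fac, Category.comp_id]
    rfl
  have hx : (filteredDesc c).toFun ((hc.desc (filteredCocone D)).toFun x) = x := congr_toFun h x
  obtain ⟨⟨j, y⟩, hy⟩ := Quotient.exists_rep ((hc.desc (filteredCocone D)).toFun x)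
  exact ⟨j, y, by rw [← hx, ← hy]; rfl⟩

theorem exists_eq_of_isColimit {i j : J} {x : (D.obj i).carrier} {y : (D.obj j).carrier}
    (h : (c.ι.app i).toFun x = (c.ι.app j).toFun y) :
    ∃ (k : J) (f : i ⟶ k) (g : j ⟶ k), (D.map f).toFun x = (D.map g).toFun y := by
  have h1 : ∀ (j : J) (z : (D.obj j).carrier),
      (hc.desc (filteredCocone D)).toFun ((c.ι.app j).toFun z) =
        Quotient.mk (filteredSetoid D) ⟨j, z⟩ :=
    fun j z => congr_toFun (hc.fac (filteredCocone D) j) z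
  exact Quotient.exact (s := filteredSetoid D) ((h1 i x).symm.trans
    ((congrArg (hc.desc (filteredCocone D)).toFun h).trans (h1 j y)))

theorem exists_eq_of_isColimit' {j : J} {x y : (D.obj j).carrier}
    (h : (c.ι.app j).toFun x = (c.ι.app j).toFun y) :
    ∃ (k : J) (f : j ⟶ k), (D.map f).toFun x = (D.map f).toFun y := by
  obtain ⟨k, f, g, hfg⟩ := exists_eq_of_isColimit hc h
  refine ⟨IsFiltered.coeq f g, f ≫ IsFiltered.coeqHom f g, ?_⟩
  rw [map_comp_toFun, hfg, ← map_comp_toFun, ← IsFiltered.coeq_condition]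

/-- Finitely many pairs of elements that agree in the colimit agree at some stage. -/
theorem exists_eq_of_isColimit_of_finite {ι : Type*} {N : Set ι} (hN : N.Finite) {j : J}
    (x y : ι → (D.obj j).carrier)
    (h : ∀ n ∈ N, (c.ι.app j).toFun (x n) = (c.ι.app j).toFun (y n)) :
    ∃ (k : J) (f : j ⟶ k), ∀ n ∈ N, (D.map f).toFun (x n) = (D.map f).toFun (y n) := by
  induction N, hN using Set.Finite.induction_on with
  | empty => exact ⟨j, 𝟙 j, by simp⟩
  | @insert a N _ _ ih =>
    obtain ⟨k, f, hf⟩ := ih fun n hn => h n (Or.inr hn)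
    obtain ⟨l, g, hg⟩ := exists_eq_of_isColimit' hc (x := (D.map f).toFun (x a))
      (y := (D.map f).toFun (y a)) (by simpa [cocone_w_toFun] using h a (Or.inl rfl))
    refine ⟨l, f ≫ g, ?_⟩
    rintro n (rfl | hn)
    · simpa using hg
    · simp [hf n hn]

/-- Every element of a filtered colimit has a representative whose stabilizer is as large as
possible. -/
theorem exists_rep_stabilizer {X : Nom V} (φ : X ⟶ c.pt) (x : X.carrier) :
    ∃ (j : J) (y : (D.obj j).carrier), (c.ι.app j).toFun y = φ.toFun x ∧
      ∀ π : FinPerm V, π • x = x → π • y = y := by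
  obtain ⟨j, y, hy⟩ := exists_rep_of_isColimit hc (φ.toFun x)
  obtain ⟨T, hT, hyT⟩ := (D.obj j).finite_support y
  -- The stabilizer of `x` may be infinite, but modulo permutations fixing the support `T` of `y`
  -- only finitely many translates of `y` must be identified with `y`; one later stage does so for
  -- all of them.
  obtain ⟨N, hNP, hN, hcover⟩ :=
    (D.obj j).exists_finite_transversal y hT {π | π • x = x}
  obtain ⟨k, f, hf⟩ := exists_eq_of_isColimit_of_finite hc hN (fun π => π • y) (fun _ => y)
    (fun π hπ => by
      have : π • x = x := hNP hπ
      rw [(c.ι.app j).equivariant, hy, ← φ.equivariant, this])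
  refine ⟨k, (D.map f).toFun y, by rw [cocone_w_toFun, hy], fun ρ hρ => ?_⟩
  obtain ⟨π, hπ, σ, hσ, h⟩ := hcover ρ hρ
  rw [← (D.map f).equivariant, ← h, (D.map f).equivariant, hf π hπ, ← (D.map f).equivariant,
    hyT σ fun a ha => hσ a ha]

end FilteredColimits

end Nom

/-! ### Finitely presentable means orbit-finite. -/

namespace Nom

variable {V : Type u}

theorem IsOrbitFinite.finite_orbits {X : Nom V} (hX : X.IsOrbitFinite) :
    Finite (MulAction.orbitRel.Quotient (FinPerm V) X.carrier) := by
  obtain ⟨F, hF, hcover⟩ := hX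
  have := hF.to_subtype
  refine Finite.of_surjective
    (fun x : F => (Quotient.mk'' x.1 : MulAction.orbitRel.Quotient (FinPerm V) X.carrier)) ?_
  rintro ⟨y⟩
  obtain ⟨x, hx, π, rfl⟩ := hcover y
  exact ⟨⟨x, hx⟩, Quotient.sound' (MulAction.orbitRel_apply.2 ⟨π⁻¹, inv_smul_smul π x⟩)⟩

/-- An equivariant map is given by its values on representatives of the orbits, provided that
their stabilizers are respected. -/
theorem exists_hom_of_orbits {X Y : Nom V}
    (z : MulAction.orbitRel.Quotient (FinPerm V) X.carrier → Y.carrier)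
    (hz : ∀ q (π : FinPerm V), π • Quotient.out q = Quotient.out q → π • z q = z q) :
    ∃ ψ : X ⟶ Y, ∀ q, ψ.toFun (Quotient.out q) = z q := by
  have hout : ∀ x : X.carrier, ∃ π : FinPerm V, π • Quotient.out
      (Quotient.mk'' x : MulAction.orbitRel.Quotient (FinPerm V) X.carrier) = x := fun x =>
    MulAction.orbitRel_apply.1 (Quotient.exact' (Quotient.out_eq'
      (Quotient.mk'' x : MulAction.orbitRel.Quotient (FinPerm V) X.carrier)).symm)
  choose p hp using hout
  -- The stabilizer condition makes the value independent of the permutation chosen to reach a point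
  -- from its orbit representative.
  have key : ∀ q (π ρ : FinPerm V), π • Quotient.out q = ρ • Quotient.out q →
      π • z q = ρ • z q := fun q π ρ h => by
    rw [← inv_smul_eq_iff, ← mul_smul] at h ⊢
    exact hz q _ h
  refine ⟨⟨fun x => p x • z (Quotient.mk'' x), fun σ x => ?_⟩, fun q => ?_⟩
  · have hq : (Quotient.mk'' (σ • x) : MulAction.orbitRel.Quotient (FinPerm V) X.carrier) =
        Quotient.mk'' x := Quotient.sound' (MulAction.orbitRel_apply.2 ⟨σ, rfl⟩)
    have h := hp (σ • x)
    rw [hq] at h ⊢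
    rw [← mul_smul]
    refine key _ _ _ ?_
    rw [h, mul_smul, hp]
  · have hq : (Quotient.mk'' (Quotient.out q) :
        MulAction.orbitRel.Quotient (FinPerm V) X.carrier) = q := Quotient.out_eq' q
    have h := hp (Quotient.out q)
    change p (Quotient.out q) • z (Quotient.mk'' (Quotient.out q)) = z q
    rw [hq] at h ⊢
    exact hz q _ h

theorem hom_ext_of_orbits {X Y : Nom V} {F : Set X.carrier}
    (hF : ∀ y, ∃ x ∈ F, ∃ π : FinPerm V, π • x = y) {f g : X ⟶ Y}
    (h : ∀ x ∈ F, f.toFun x = g.toFun x) : f = g :=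
  hom_ext fun y => by
    obtain ⟨x, hx, π, rfl⟩ := hF y
    rw [f.equivariant, g.equivariant, h x hx]

/-- Each of the finitely many orbit representatives lifts to some stage with its stabilizer
respected. At a common later stage these lifts define an equivariant map. -/
theorem IsOrbitFinite.exists_factorization {X : Nom V} (hX : X.IsOrbitFinite) {J : Type u}
    [SmallCategory J] [IsFiltered J] {D : J ⥤ Nom V} {c : Cocone D} (hc : IsColimit c)
    (φ : X ⟶ c.pt) : ∃ (j : J) (ψ : X ⟶ D.obj j), ψ ≫ c.ι.app j = φ := by
  classical
  have := hX.finite_orbits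
  have := Fintype.ofFinite (MulAction.orbitRel.Quotient (FinPerm V) X.carrier)
  choose j y hy hstab using
    fun q : MulAction.orbitRel.Quotient (FinPerm V) X.carrier =>
      exists_rep_stabilizer hc φ (Quotient.out q)
  obtain ⟨k, hk⟩ := IsFiltered.sup_objs_exists (Finset.univ.image j)
  have f : ∀ q, j q ⟶ k := fun q =>
    (hk (Finset.mem_image_of_mem j (Finset.mem_univ q))).some
  obtain ⟨ψ, hψ⟩ := exists_hom_of_orbits (Y := D.obj k) (fun q => (D.map (f q)).toFun (y q))
    (fun q π h => by rw [← (D.map (f q)).equivariant, hstab q π h])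
  refine ⟨k, ψ, hom_ext_of_orbits 
    (F := Set.range (Quotient.out (s := MulAction.orbitRel (FinPerm V) X.carrier))) (fun x => ?_) ?_⟩
  · exact ⟨_, ⟨Quotient.mk'' x, rfl⟩, MulAction.orbitRel_apply.1 (Quotient.exact'
      (Quotient.out_eq' (Quotient.mk'' x :
        MulAction.orbitRel.Quotient (FinPerm V) X.carrier)).symm)⟩
  · rintro _ ⟨q, rfl⟩
    rw [comp_toFun, hψ, cocone_w_toFun, hy]

theorem IsOrbitFinite.exists_eq {X : Nom V} (hX : X.IsOrbitFinite) {J : Type u}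
    [SmallCategory J] [IsFiltered J] {D : J ⥤ Nom V} {c : Cocone D} (hc : IsColimit c)
    {i j : J} (φ : X ⟶ D.obj i) (ψ : X ⟶ D.obj j) (h : φ ≫ c.ι.app i = ψ ≫ c.ι.app j) :
    ∃ (k : J) (f : i ⟶ k) (g : j ⟶ k), φ ≫ D.map f = ψ ≫ D.map g := by
  obtain ⟨F, hF, hcover⟩ := hX
  let a := IsFiltered.leftToMax i j
  let b := IsFiltered.rightToMax i j
  obtain ⟨k, f, hf⟩ := exists_eq_of_isColimit_of_finite hc hF
    (fun x => (D.map a).toFun (φ.toFun x)) (fun x => (D.map b).toFun (ψ.toFun x))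
    (fun x _ => by
      rw [cocone_w_toFun, cocone_w_toFun]
      exact congr_toFun h x)
  refine ⟨k, a ≫ f, b ≫ f, hom_ext_of_orbits hcover fun x hx => ?_⟩
  rw [comp_toFun, comp_toFun, map_comp_toFun, map_comp_toFun, hf x hx]

theorem IsOrbitFinite.isFinitelyPresentable {X : Nom V} (hX : X.IsOrbitFinite) :
    IsFinitelyPresentable.{u} X := by
  rw [isFinitelyPresentable_iff_preservesFilteredColimits]
  refine ⟨fun J _ _ => ⟨fun {D} => ⟨fun {c} hc => ⟨?_⟩⟩⟩⟩
  refine Types.FilteredColimit.isColimitOf _ _ (fun φ => ?_) fun i j φ ψ h => ?_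
  · obtain ⟨j, ψ, h⟩ := hX.exists_factorization hc φ
    exact ⟨j, ψ, h.symm⟩
  · exact hX.exists_eq hc φ ψ h

/-! ### Nominal sets as colimits of finitely generated subsets. -/

section Orbits

variable (X : Nom V)

/-- The nominal subset generated by a finite set of elements. -/
def generated (F : Finset X.carrier) : Nom V where
  carrier := {y : X.carrier // ∃ x ∈ F, ∃ π : FinPerm V, π • x = y}
  action :=
    { smul := fun σ y => ⟨σ • y.1, by
        obtain ⟨x, hx, π, h⟩ := y.2
        exact ⟨x, hx, σ * π, by rw [mul_smul, h]⟩⟩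
      one_smul := fun y => Subtype.ext (one_smul _ y.1)
      mul_smul := fun π σ y => Subtype.ext (mul_smul π σ y.1) }
  finite_support := fun y => by
    obtain ⟨S, hS, hy⟩ := X.finite_support y.1
    exact ⟨S, hS, fun π h => Subtype.ext (hy π h)⟩

/-- The diagram of finitely generated nominal subsets. -/
def generatedFunctor : Finset X.carrier ⥤ Nom V where
  obj F := X.generated F
  map f := ⟨fun y => ⟨y.1, y.2.imp fun _ h => ⟨leOfHom f h.1, h.2⟩⟩, fun _ _ => rfl⟩

/-- The cocone of inclusions of the finitely generated nominal subsets. -/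
def generatedCocone : Cocone X.generatedFunctor where
  pt := X
  ι := { app := fun F => ⟨fun y => y.1, fun _ _ => rfl⟩ }

theorem generated_cocone_eq {X : Nom V} (s : Cocone X.generatedFunctor) {F G : Finset X.carrier}
    (y : X.carrier) (hF : ∃ x ∈ F, ∃ π : FinPerm V, π • x = y)
    (hG : ∃ x ∈ G, ∃ π : FinPerm V, π • x = y) :
    (s.ι.app F).toFun ⟨y, hF⟩ = (s.ι.app G).toFun ⟨y, hG⟩ := by
  classical
  have h1 := cocone_w_toFun s (homOfLE (Finset.subset_union_left : F ⊆ F ∪ G)) ⟨y, hF⟩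
  have h2 := cocone_w_toFun s (homOfLE (Finset.subset_union_right : G ⊆ F ∪ G)) ⟨y, hG⟩
  exact h1.symm.trans h2

/-- A nominal set is the filtered colimit of its finitely generated nominal subsets. -/
def generatedIsColimit : IsColimit X.generatedCocone where
  desc s :=
    { toFun := fun x => (s.ι.app {x}).toFun ⟨x, x, Finset.mem_singleton_self x, 1, one_smul _ x⟩
      equivariant := fun π x => by
        refine (generated_cocone_eq s (F := {π • x}) (G := {x}) _ _
          ⟨x, Finset.mem_singleton_self x, π, rfl⟩).trans ?_
        exact (s.ι.app {x}).equivariant π ⟨x, x, Finset.mem_singleton_self x, 1, one_smul _ x⟩ }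
  fac s F := hom_ext fun y => generated_cocone_eq s y.1 _ y.2
  uniq s m hm := hom_ext fun x => by
    exact congr_toFun (hm {x}) ⟨x, x, Finset.mem_singleton_self x, 1, one_smul _ x⟩

/-- The identity factors through a finitely generated nominal subset, which is therefore everything.
-/
theorem isOrbitFinite_of_isFinitelyPresentable [IsFinitelyPresentable.{u} X] :
    X.IsOrbitFinite := by
  classical
  obtain ⟨F, p, hp⟩ :=
    IsFinitelyPresentable.exists_hom_of_isColimit X.generatedIsColimit (𝟙 X)
  refine ⟨F, F.finite_toSet, fun y => ?_⟩
  have hy : (p.toFun y).1 = y := congr_toFun hp y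
  obtain ⟨x, hx, π, h⟩ := (p.toFun y).2
  exact ⟨x, hx, π, h.trans hy⟩

end Orbits

theorem isFinitelyPresentable_iff_isOrbitFinite {X : Nom V} :
    IsFinitelyPresentable.{u} X ↔ X.IsOrbitFinite :=
  ⟨fun _ => X.isOrbitFinite_of_isFinitelyPresentable, fun h => h.isFinitelyPresentable⟩

end Nom

/-! ### Unfolding states of coalgebras into trees. -/

section Unfolding

open LambdaTree

variable {V : Type u}

/-- The root label of an element of `L X`. -/
def rootLabel {X : Type u} : V ⊕ (V × X) ⊕ (X × X) → Label V
  | .inl v => .var v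
  | .inr (.inl p) => .lam p.1
  | .inr (.inr _) => .app

/-- The `i`-th successor of an element of `L X`, if it exists. -/
def successor {X : Type u} : V ⊕ (V × X) ⊕ (X × X) → Fin 2 → Option X
  | .inl _, _ => none
  | .inr (.inl p), 0 => some p.2
  | .inr (.inl _), 1 => none
  | .inr (.inr p), 0 => some p.1
  | .inr (.inr p), 1 => some p.2

theorem successor_isSome {X : Type u} (s : V ⊕ (V × X) ⊕ (X × X)) (i : Fin 2) :
    (successor s i).isSome ↔ (i : ℕ) < (rootLabel s).arity := by
  rcases s with v | p | p <;> fin_cases i <;> simp [successor, rootLabel, Label.arity]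

theorem rootLabel_map {X Y : Nom V} (f : X ⟶ Y) (s : ((lamFunctor V).obj X).carrier) :
    rootLabel (((lamFunctor V).map f).toFun s) = rootLabel s := by
  rcases s with v | p | p <;> rfl

theorem successor_map {X Y : Nom V} (f : X ⟶ Y) (s : ((lamFunctor V).obj X).carrier)
    (i : Fin 2) :
    successor (((lamFunctor V).map f).toFun s) i = (successor s i).map f.toFun := by
  rcases s with v | p | p <;> fin_cases i <;> rfl

theorem rootLabel_smul {X : Nom V} (π : FinPerm V) (s : ((lamFunctor V).obj X).carrier) :
    rootLabel (π • s) = (rootLabel s).rename π := by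
  rcases s with v | p | p <;> rfl

theorem successor_smul {X : Nom V} (π : FinPerm V) (s : ((lamFunctor V).obj X).carrier)
    (i : Fin 2) : successor (π • s) i = (successor s i).map (π • ·) := by
  rcases s with v | p | p <;> fin_cases i <;> rfl

namespace CategoryTheory.Endofunctor.Coalgebra

variable (A : Endofunctor.Coalgebra (lamFunctor V))

/-- The partial labelling of positions obtained by unfolding a state of a coalgebra. -/
def unfoldLabel : List (Fin 2) → A.V.carrier → Option (Label V)
  | [], x => some (rootLabel (A.str.toFun x))
  | i :: p, x => (successor (A.str.toFun x) i).bind (unfoldLabel p)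

theorem unfoldLabel_isSome_child (p : List (Fin 2)) (i : Fin 2) (x : A.V.carrier) :
    (A.unfoldLabel (p ++ [i]) x).isSome ↔
      ∃ l, A.unfoldLabel p x = some l ∧ (i : ℕ) < l.arity := by
  induction p generalizing x with
  | nil =>
    have h := successor_isSome (A.str.toFun x) i
    change ((successor (A.str.toFun x) i).bind fun y => some _).isSome ↔ ∃ l, some _ = some l ∧ _
    simp only [Option.some.injEq, exists_eq_left', ← h]
    cases successor (A.str.toFun x) i <;> simp
  | cons j p ih =>
    change ((successor (A.str.toFun x) j).bind (A.unfoldLabel (p ++ [i]))).isSome ↔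
      ∃ l, (successor (A.str.toFun x) j).bind (A.unfoldLabel p) = some l ∧ _
    cases successor (A.str.toFun x) j with
    | none => simp
    | some y => exact ih y

/-- The tree obtained by unfolding a state of a coalgebra. -/
def unfold (x : A.V.carrier) : LambdaTree V where
  label p := A.unfoldLabel p x
  root_isSome := rfl
  isSome_child p i := A.unfoldLabel_isSome_child p i x

theorem unfoldLabel_smul (π : FinPerm V) (p : List (Fin 2)) (x : A.V.carrier) :
    A.unfoldLabel p (π • x) = (A.unfoldLabel p x).map (Label.rename π) := by
  induction p generalizing x with
  | nil => simp only [unfoldLabel, A.str.equivariant, rootLabel_smul, Option.map_some]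
  | cons i p ih =>
    simp only [unfoldLabel, A.str.equivariant, successor_smul]
    cases successor (A.str.toFun x) i with
    | none => rfl
    | some y => exact ih y

theorem unfold_smul (π : FinPerm V) (x : A.V.carrier) :
    A.unfold (π • x) = π • A.unfold x :=
  LambdaTree.ext (funext fun p => A.unfoldLabel_smul π p x)

variable {A} in
theorem supports_successor {S : Set V} {x y : A.V.carrier} {i : Fin 2}
    (hx : MulAction.Supports (FinPerm V) S x) (h : successor (A.str.toFun x) i = some y) :
    MulAction.Supports (FinPerm V) S y := fun π hπ => by
  have h1 := successor_smul π (A.str.toFun x) i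
  rw [← A.str.equivariant, hx π hπ, h] at h1
  exact (Option.some.inj h1).symm

variable {A} in
theorem supports_rootLabel [Infinite V] {S : Set V} (hS : S.Finite) {x : A.V.carrier}
    (hx : MulAction.Supports (FinPerm V) S x) {v : V}
    (h : (rootLabel (A.str.toFun x)).name = some v) : v ∈ S := by
  refine (supports_variable_iff hS).1 fun π hπ => ?_
  have h1 := rootLabel_smul π (A.str.toFun x)
  rw [← A.str.equivariant, hx π hπ] at h1
  revert h h1
  cases rootLabel (A.str.toFun x) with
  | var w => intro h h1; cases h; exact (Label.var.inj h1).symm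
  | lam w => intro h h1; cases h; exact (Label.lam.inj h1).symm
  | app => intro h; cases h

/-- A subtree of the unfolding of a state is the unfolding of a state with smaller support. -/
theorem exists_unfoldLabel_append {p : List (Fin 2)} {x : A.V.carrier}
    (h : (A.unfoldLabel p x).isSome) :
    ∃ y : A.V.carrier, (∀ S : Set V, MulAction.Supports (FinPerm V) S x →
        MulAction.Supports (FinPerm V) S y) ∧
      ∀ q, A.unfoldLabel (p ++ q) x = A.unfoldLabel q y := by
  induction p generalizing x with
  | nil => exact ⟨x, fun _ h => h, fun _ => rfl⟩
  | cons i p ih =>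
    change ((successor (A.str.toFun x) i).bind (A.unfoldLabel p)).isSome at h
    rcases hy : successor (A.str.toFun x) i with _ | y
    · rw [hy] at h
      cases h
    · rw [hy] at h
      obtain ⟨z, hz, hq⟩ := ih h
      refine ⟨z, fun S hS => hz S (supports_successor hS hy), fun q => ?_⟩
      change (successor (A.str.toFun x) i).bind (A.unfoldLabel (p ++ q)) = _
      rw [hy]
      exact hq q

theorem exists_subtree_unfold (x : A.V.carrier) (p : List (Fin 2))
    (hp : ((A.unfold x).label p).isSome) :
    ∃ y : A.V.carrier, (∀ S : Set V, MulAction.Supports (FinPerm V) S x →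
        MulAction.Supports (FinPerm V) S y) ∧
      (A.unfold x).subtree p hp = A.unfold y := by
  obtain ⟨y, hy, h⟩ := A.exists_unfoldLabel_append hp
  exact ⟨y, hy, LambdaTree.ext (funext h)⟩

theorem hasFiniteVars_unfold [Infinite V] (x : A.V.carrier) : (A.unfold x).HasFiniteVars := by
  obtain ⟨S, hS, hx⟩ := A.V.finite_support x
  refine hS.subset ?_
  rintro v ⟨p, l, hl, hv⟩
  have hp : (A.unfoldLabel p x).isSome := Option.isSome_iff_exists.2 ⟨l, hl⟩
  obtain ⟨y, hy, h⟩ := A.exists_unfoldLabel_append hp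
  have h0 : A.unfoldLabel p x = some (rootLabel (A.str.toFun y)) := by
    rw [← List.append_nil p, h []]
    rfl
  obtain rfl : rootLabel (A.str.toFun y) = l := Option.some.inj (h0.symm.trans hl)
  exact supports_rootLabel hS (hy S hx) hv

/-- Every subtree is the unfolding of a state supported by a fixed finite support of `x`, and there
are finitely many such states. -/
theorem isRational_unfold (hA : A.V.IsOrbitFinite) (x : A.V.carrier) :
    (A.unfold x).IsRational := by
  obtain ⟨S, hS, hx⟩ := A.V.finite_support x
  refine ((hA.finite_supported hS).image A.unfold).subset ?_
  rintro s ⟨p, hp, rfl⟩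
  obtain ⟨y, hy, h⟩ := A.exists_subtree_unfold x p hp
  exact ⟨y, hy S hx, h.symm⟩

variable {A} in
theorem str_hom {B : Endofunctor.Coalgebra (lamFunctor V)} (f : A ⟶ B) (x : A.V.carrier) :
    B.str.toFun (f.f.toFun x) = ((lamFunctor V).map f.f).toFun (A.str.toFun x) :=
  (Nom.congr_toFun f.h x).symm

variable {A} in
theorem unfoldLabel_hom {B : Endofunctor.Coalgebra (lamFunctor V)} (f : A ⟶ B)
    (p : List (Fin 2)) (x : A.V.carrier) :
    B.unfoldLabel p (f.f.toFun x) = A.unfoldLabel p x := by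
  induction p generalizing x with
  | nil => simp only [unfoldLabel, str_hom, rootLabel_map]
  | cons i p ih =>
    simp only [unfoldLabel, str_hom, successor_map]
    cases successor (A.str.toFun x) i with
    | none => rfl
    | some y => exact ih y

variable {A} in
theorem unfold_hom {B : Endofunctor.Coalgebra (lamFunctor V)} (f : A ⟶ B) (x : A.V.carrier) :
    B.unfold (f.f.toFun x) = A.unfold x :=
  LambdaTree.ext (funext fun p => unfoldLabel_hom f p x)

end CategoryTheory.Endofunctor.Coalgebra

/-! ### Coalgebras of trees and finality. -/

section TreeCoalgebra

open CategoryTheory.Endofunctor.Coalgebra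

variable {P : LambdaTree V → Prop}
  (hP : ∀ t, P t → ∀ (p : List (Fin 2)) (hp : (t.label p).isSome), P (t.subtree p hp))
  (hπ : ∀ t, P t → ∀ π : FinPerm V, P (π • t)) (hfin : ∀ t, P t → t.HasFiniteVars)

/-- Trees constrain positions at their last index, whereas unfolding recurses on the first.
Induction from the right end of `p` bridges the two. -/
theorem label_cons_eq_none {t : LambdaTree V} {i : Fin 2} {l : Label V}
    (hl : t.label [] = some l) (hi : ¬ (i : ℕ) < l.arity) (p : List (Fin 2)) :
    t.label (i :: p) = none := by
  induction p using List.reverseRecOn with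
  | nil =>
    rw [← Option.not_isSome_iff_eq_none]
    intro h
    obtain ⟨l', hl', hi'⟩ := (t.isSome_child [] i).1 h
    cases hl.symm.trans hl'
    exact hi hi'
  | append_singleton p j ih =>
    rw [← Option.not_isSome_iff_eq_none]
    intro h
    obtain ⟨l', hl', -⟩ := (t.isSome_child (i :: p) j).1 h
    cases ih.symm.trans hl'

theorem unfoldLabel_treeCoalgebra (p : List (Fin 2)) (t : {t : LambdaTree V // P t}) :
    (treeCoalgebra P hP hπ hfin).unfoldLabel p t = t.1.label p := by
  induction p generalizing t with
  | nil =>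
    obtain ⟨l, hl⟩ := Option.isSome_iff_exists.1 t.1.root_isSome
    change some (rootLabel (decompose P hP t)) = _
    rcases l with x | x | _
    · rw [decompose_var hP t hl, hl]; rfl
    · rw [decompose_lam hP t hl, hl]; rfl
    · rw [decompose_app hP t hl, hl]; rfl
  | cons i p ih =>
    obtain ⟨l, hl⟩ := Option.isSome_iff_exists.1 t.1.root_isSome
    change (successor (decompose P hP t) i).bind
      ((treeCoalgebra P hP hπ hfin).unfoldLabel p) = _
    rcases l with x | x | _
    · rw [decompose_var hP t hl, label_cons_eq_none hl (by simp [Label.arity])]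
      rfl
    · rw [decompose_lam hP t hl]
      fin_cases i
      · exact ih _
      · exact (label_cons_eq_none hl (by simp [Label.arity]) p).symm
    · rw [decompose_app hP t hl]
      fin_cases i <;> exact ih _

theorem unfold_treeCoalgebra (t : {t : LambdaTree V // P t}) :
    (treeCoalgebra P hP hπ hfin).unfold t = t.1 :=
  LambdaTree.ext (funext fun p => unfoldLabel_treeCoalgebra hP hπ hfin p t)

variable {hP hπ hfin}

/-- Homomorphisms preserve unfoldings, and a tree, as a state, unfolds to itself. -/
theorem coe_hom_treeCoalgebra {A : Endofunctor.Coalgebra (lamFunctor V)}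
    (f : A ⟶ treeCoalgebra P hP hπ hfin) (x : A.V.carrier) :
    Subtype.val (p := P) (f.f.toFun x) = A.unfold x := by
  rw [← unfold_hom f x]
  exact (unfold_treeCoalgebra hP hπ hfin (f.f.toFun x)).symm

theorem hom_treeCoalgebra_ext {A : Endofunctor.Coalgebra (lamFunctor V)}
    (f g : A ⟶ treeCoalgebra P hP hπ hfin) : f = g :=
  Endofunctor.Coalgebra.ext (Nom.hom_ext fun x => Subtype.ext
    ((coe_hom_treeCoalgebra f x).trans (coe_hom_treeCoalgebra g x).symm))

variable (hP hπ hfin)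

/-- The unfolding of states as an equivariant map. -/
def unfoldMap (A : Endofunctor.Coalgebra (lamFunctor V)) (h : ∀ x, P (A.unfold x)) :
    A.V ⟶ treeNom P hπ hfin where
  toFun x := (⟨A.unfold x, h x⟩ : {t : LambdaTree V // P t})
  equivariant π x := Subtype.ext (A.unfold_smul π x)

/-- The unfolding of states is a homomorphism into every coalgebra of trees that contains all the
unfoldings. -/
def unfoldHom (A : Endofunctor.Coalgebra (lamFunctor V)) (h : ∀ x, P (A.unfold x)) :
    A ⟶ treeCoalgebra P hP hπ hfin where
  f := unfoldMap hπ hfin A h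
  h := Nom.hom_ext fun x => by
    have hroot : (A.unfold x).label [] = some (rootLabel (A.str.toFun x)) := rfl
    have hsub : ∀ i hi y, successor (A.str.toFun x) i = some y →
        (A.unfold x).subtree [i] hi = A.unfold y := fun i hi y hy => by
      refine LambdaTree.ext (funext fun q => ?_)
      change (successor (A.str.toFun x) i).bind (A.unfoldLabel q) = _
      rw [hy]
      rfl
    change ((lamFunctor V).map (unfoldMap hπ hfin A h)).toFun (A.str.toFun x) =
      decompose P hP ⟨A.unfold x, h x⟩
    rcases hs : A.str.toFun x with v | ⟨v, y⟩ | ⟨y, z⟩ <;> rw [hs] at hroot hsub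
    · rw [decompose_var hP ⟨A.unfold x, h x⟩ hroot]
      rfl
    · rw [decompose_lam hP ⟨A.unfold x, h x⟩ hroot]
      exact congrArg (Sum.inr ∘ Sum.inl)
        (Prod.ext rfl
          (Subtype.ext (hsub 0 (isSome_succ hroot 0 (by simp [rootLabel, Label.arity])) y rfl).symm))
    · rw [decompose_app hP ⟨A.unfold x, h x⟩ hroot]
      exact congrArg (Sum.inr ∘ Sum.inr)
        (Prod.ext
          (Subtype.ext (hsub 0 (isSome_succ hroot 0 (by simp [rootLabel, Label.arity])) y rfl).symm)
          (Subtype.ext (hsub 1 (isSome_succ hroot 1 (by simp [rootLabel, Label.arity])) z rfl).symm))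

end TreeCoalgebra

/-- The trees in which only finitely many variables occur form the final coalgebra. -/
def finVarsIsTerminal [Infinite V] : IsTerminal (finVarsCoalgebra V) :=
  IsTerminal.ofUniqueHom (fun A => unfoldHom _ _ _ A A.hasFiniteVars_unfold)
    fun _ _ => hom_treeCoalgebra_ext _ _

end Unfolding

/-! ### Rational trees as the colimit. -/

section RationalTrees

open LambdaTree CategoryTheory.Endofunctor.Coalgebra

variable {V : Type u}

theorem fpCarrier_iff {A : Endofunctor.Coalgebra (lamFunctor V)} :
    fpCarrier (lamFunctor V) A ↔ A.V.IsOrbitFinite :=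
  Nom.isFinitelyPresentable_iff_isOrbitFinite

/-- The coalgebra of all renamings of subtrees of a given rational tree. -/
def LambdaTree.IsRational.generated {t : LambdaTree V} (ht : t.IsRational) :
    Endofunctor.Coalgebra (lamFunctor V) :=
  treeCoalgebra (fun s => ∃ u ∈ t.subtrees, ∃ π : FinPerm V, π • u = s)
    (by
      rintro _ ⟨u, hu, π, rfl⟩ p hp
      exact ⟨u.subtree p (isSome_smul.1 hp), by
        obtain ⟨q, hq, rfl⟩ := hu
        exact t.subtrees_subtree q hq ⟨p, isSome_smul.1 hp, rfl⟩, π, rfl⟩)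
    (by
      rintro _ ⟨u, hu, π, rfl⟩ σ
      exact ⟨u, hu, σ * π, mul_smul σ π u⟩)
    (by
      rintro _ ⟨_, ⟨p, hp, rfl⟩, π, rfl⟩
      exact (ht.hasFiniteVars.subtree p hp).smul π)

theorem LambdaTree.IsRational.unfold_generated {t : LambdaTree V} (ht : t.IsRational)
    (s : {s : LambdaTree V // ∃ u ∈ t.subtrees, ∃ π : FinPerm V, π • u = s}) :
    ht.generated.unfold s = s.1 :=
  unfold_treeCoalgebra _ _ _ s

/-- A rational tree as a state of the coalgebra it generates. -/
def LambdaTree.IsRational.root {t : LambdaTree V} (ht : t.IsRational) :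
    ht.generated.V.carrier :=
  (⟨t, t, ⟨[], t.root_isSome, rfl⟩, 1, one_smul _ t⟩ :
    {s : LambdaTree V // ∃ u ∈ t.subtrees, ∃ π : FinPerm V, π • u = s})

theorem LambdaTree.IsRational.unfold_root {t : LambdaTree V} (ht : t.IsRational) :
    ht.generated.unfold ht.root = t :=
  ht.unfold_generated _

/-- The finitely many subtrees of `t` meet every orbit. -/
theorem LambdaTree.IsRational.fpCarrier_generated {t : LambdaTree V} (ht : t.IsRational) :
    fpCarrier (lamFunctor V) ht.generated := by
  refine fpCarrier_iff.2 ⟨{s | s.1 ∈ t.subtrees}, ?_, ?_⟩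
  · exact Set.Finite.preimage Subtype.val_injective.injOn ht
  · rintro ⟨s, u, hu, π, rfl⟩
    exact ⟨⟨u, u, hu, 1, one_smul _ u⟩, hu, π, rfl⟩

/-- The coalgebra of all unfoldings of states of an orbit-finite coalgebra. -/
def imageCoalgebra (A : Endofunctor.Coalgebra (lamFunctor V)) (hA : A.V.IsOrbitFinite) :
    Endofunctor.Coalgebra (lamFunctor V) :=
  treeCoalgebra (fun s => ∃ x, A.unfold x = s)
    (by
      rintro _ ⟨x, rfl⟩ p hp
      obtain ⟨y, -, h⟩ := A.exists_subtree_unfold x p hp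
      exact ⟨y, h.symm⟩)
    (by
      rintro _ ⟨x, rfl⟩ π
      exact ⟨π • x, A.unfold_smul π x⟩)
    (by
      rintro _ ⟨x, rfl⟩
      exact (A.isRational_unfold hA x).hasFiniteVars)

/-- The unfolding map onto the image coalgebra. -/
def toImageCoalgebra (A : Endofunctor.Coalgebra (lamFunctor V)) (hA : A.V.IsOrbitFinite) :
    A ⟶ imageCoalgebra A hA :=
  unfoldHom _ _ _ A fun x => ⟨x, rfl⟩

theorem fpCarrier_imageCoalgebra (A : Endofunctor.Coalgebra (lamFunctor V))
    (hA : A.V.IsOrbitFinite) : fpCarrier (lamFunctor V) (imageCoalgebra A hA) :=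
  fpCarrier_iff.2 (hA.of_surjective (toImageCoalgebra A hA).f (by
    rintro ⟨_, x, rfl⟩
    exact ⟨x, rfl⟩))

/-- The inclusion of the coalgebra generated by the unfolding of a state. -/
def generatedToImage (A : Endofunctor.Coalgebra (lamFunctor V)) (hA : A.V.IsOrbitFinite)
    (x : A.V.carrier) : (A.isRational_unfold hA x).generated ⟶ imageCoalgebra A hA :=
  unfoldHom _ _ _ _ (by
    rintro ⟨s, u, ⟨p, hp, rfl⟩, π, rfl⟩
    obtain ⟨y, -, h⟩ := A.exists_subtree_unfold x p hp
    exact ⟨π • y, by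
      rw [A.unfold_smul, ← h]
      exact (IsRational.unfold_generated (A.isRational_unfold hA x)
        ⟨_, _, ⟨p, hp, rfl⟩, π, rfl⟩).symm⟩)

theorem toImage_eq_generatedToImage (A : Endofunctor.Coalgebra (lamFunctor V))
    (hA : A.V.IsOrbitFinite) (x : A.V.carrier) :
    (toImageCoalgebra A hA).f.toFun x =
      (generatedToImage A hA x).f.toFun (A.isRational_unfold hA x).root :=
  Subtype.ext (A.isRational_unfold hA x).unfold_root.symm

variable (V) in
/-- The cocone of unfolding maps into the coalgebra of rational trees. -/
def rationalCocone : (fpCarrier (lamFunctor V)).ι ⟶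
    (Functor.const (fpCarrier (lamFunctor V)).FullSubcategory).obj (rationalCoalgebra V) where
  app A := unfoldHom _ _ _ A.obj (A.obj.isRational_unfold (fpCarrier_iff.1 A.property))
  naturality _ _ _ := hom_treeCoalgebra_ext _ _

/-- The leg of a cocone at a coalgebra with finitely presentable carrier. -/
def leg (s : Cocone (fpCarrier (lamFunctor V)).ι) (A : Endofunctor.Coalgebra (lamFunctor V))
    (hA : fpCarrier (lamFunctor V) A) : A ⟶ s.pt :=
  s.ι.app ⟨A, hA⟩

theorem leg_hom (s : Cocone (fpCarrier (lamFunctor V)).ι)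
    {A B : Endofunctor.Coalgebra (lamFunctor V)} (hA : fpCarrier (lamFunctor V) A)
    (hB : fpCarrier (lamFunctor V) B) (f : A ⟶ B) (x : A.V.carrier) :
    (leg s B hB).f.toFun (f.f.toFun x) = (leg s A hA).f.toFun x := by
  have h := s.w (j := ⟨B, hB⟩) (j' := ⟨A, hA⟩) (ObjectProperty.homMk f)
  exact Nom.congr_toFun (congrArg Endofunctor.Coalgebra.Hom.f h) x

/-- The value of a cocone at a rational tree. -/
def legTree (s : Cocone (fpCarrier (lamFunctor V)).ι) (t : {t : LambdaTree V // t.IsRational}) :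
    s.pt.V.carrier :=
  (leg s t.2.generated t.2.fpCarrier_generated).f.toFun t.2.root

/-- The zigzag from `A` to its image coalgebra and back to the coalgebra generated by the unfolding
of `x` lies in the diagram. It relates `x` to the root, so a cocone takes the same value on both. -/
theorem legTree_unfold (s : Cocone (fpCarrier (lamFunctor V)).ι)
    (A : Endofunctor.Coalgebra (lamFunctor V)) (hA : fpCarrier (lamFunctor V) A)
    (x : A.V.carrier) {t : {t : LambdaTree V // t.IsRational}} (ht : A.unfold x = t.1) :
    legTree s t = (leg s A hA).f.toFun x := by
  obtain ⟨t, h⟩ := t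
  subst ht
  have hA' := fpCarrier_iff.1 hA
  rw [← leg_hom s hA (fpCarrier_imageCoalgebra A hA') (toImageCoalgebra A hA') x,
    toImage_eq_generatedToImage, leg_hom]
  rfl

/-- The map from the rational trees induced by a cocone. -/
def rationalDesc (s : Cocone (fpCarrier (lamFunctor V)).ι) : rationalCoalgebra V ⟶ s.pt where
  f :=
    { toFun := legTree s
      equivariant := fun π t => by
        have ht : IsRational (Subtype.val (p := IsRational) t) := Subtype.prop t
        refine (legTree_unfold s ht.generated ht.fpCarrier_generated (π • ht.root) ?_).trans
          ((leg s _ _).f.equivariant π ht.root)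
        rw [unfold_smul, ht.unfold_root]
        rfl }
  h := Nom.hom_ext fun t => by
    have ht : IsRational (Subtype.val (p := IsRational) t) := Subtype.prop t
    -- The tree `t` is the image of the root of `A` under `e`. Compatibility with the structure maps
    -- at `t` then follows from that of `e` and of the leg at `A`, whose map factors as `e` followed
    -- by `legTree s`.
    let A := ht.generated
    have hA := ht.fpCarrier_generated
    let e : A ⟶ rationalCoalgebra V := (rationalCocone V).app ⟨A, hA⟩
    have he : e.f.toFun ht.root = t := Subtype.ext ht.unfold_root
    have hleg : ∀ x : A.V.carrier, legTree s (e.f.toFun x) = (leg s A hA).f.toFun x :=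
      fun x => legTree_unfold s A hA x rfl
    conv_lhs => rw [← he]
    conv_rhs => rw [← he]
    rw [Nom.comp_toFun, Nom.comp_toFun, str_hom e, ← Nom.comp_toFun, ← Functor.map_comp]
    change _ = s.pt.str.toFun (legTree s (e.f.toFun ht.root))
    rw [hleg, str_hom]
    refine congrArg (fun φ => ((lamFunctor V).map φ).toFun (A.str.toFun ht.root)) ?_
    exact Nom.hom_ext hleg

/-- The rational trees form a colimit of all coalgebras with finitely presentable carrier. -/
def rationalIsColimit : IsColimit (Cocone.mk (rationalCoalgebra V) (rationalCocone V)) where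
  desc := rationalDesc
  fac s A := Endofunctor.Coalgebra.ext (Nom.hom_ext fun x =>
    legTree_unfold s A.obj A.property x rfl)
  uniq s m hm := Endofunctor.Coalgebra.ext (Nom.hom_ext fun t => by
    have ht : IsRational (Subtype.val (p := IsRational) t) := Subtype.prop t
    have h := Nom.congr_toFun
      (congrArg Endofunctor.Coalgebra.Hom.f (hm ⟨ht.generated, ht.fpCarrier_generated⟩)) ht.root
    have he : (((rationalCocone V).app ⟨ht.generated, ht.fpCarrier_generated⟩).f).toFun ht.root =
        t := Subtype.ext ht.unfold_root
    refine Eq.trans ?_ h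
    exact congrArg m.f.toFun he.symm)

theorem isRationalFixpoint_rationalCoalgebra :
    IsRationalFixpoint (lamFunctor V) (rationalCoalgebra V) :=
  ⟨rationalCocone V, ⟨rationalIsColimit⟩⟩

theorem IsRationalFixpoint.nonempty_iso {C : Type u} [Category.{v} C] {F : C ⥤ C}
    {R S : Endofunctor.Coalgebra F} (hR : IsRationalFixpoint F R) (hS : IsRationalFixpoint F S) :
    Nonempty (R ≅ S) := by
  obtain ⟨τ, ⟨h⟩⟩ := hR
  obtain ⟨σ, ⟨k⟩⟩ := hS
  exact ⟨h.coconePointUniqueUpToIso k⟩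

end RationalTrees

/-! ### Comparison with the final coalgebra. -/

open LambdaTree CategoryTheory.Endofunctor.Coalgebra in
-- Both `i` and `e.hom` send a state to its unfolding, so `i` is the bijection `e.hom` followed by
-- the inclusion of rational trees.
theorem hom_finVarsCoalgebra_of_iso {V : Type u} {R : Endofunctor.Coalgebra (lamFunctor V)}
    (e : R ≅ rationalCoalgebra V) (i : R ⟶ finVarsCoalgebra V) :
    Function.Injective i.f.toFun ∧ ∀ t : {t : LambdaTree V // t.HasFiniteVars},
      (∃ x : R.V.carrier, i.f.toFun x = t) ↔ t.1.IsRational := by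
  have hval : ∀ x, Subtype.val (p := HasFiniteVars) (i.f.toFun x) =
      Subtype.val (p := IsRational) (e.hom.f.toFun x) := fun x =>
    (coe_hom_treeCoalgebra i x).trans (coe_hom_treeCoalgebra e.hom x).symm
  have hinv : ∀ x, e.inv.f.toFun (e.hom.f.toFun x) = x := fun x =>
    Nom.congr_toFun (congrArg Endofunctor.Coalgebra.Hom.f e.hom_inv_id) x
  have hinv' : ∀ x, e.hom.f.toFun (e.inv.f.toFun x) = x := fun x =>
    Nom.congr_toFun (congrArg Endofunctor.Coalgebra.Hom.f e.inv_hom_id) x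
  refine ⟨fun x y hxy => ?_, fun t => ⟨?_, fun ht => ?_⟩⟩
  · have h : e.hom.f.toFun x = e.hom.f.toFun y :=
      Subtype.ext ((hval x).symm.trans ((congrArg Subtype.val hxy).trans (hval y)))
    rw [← hinv x, h, hinv]
  · rintro ⟨x, rfl⟩
    exact (hval x).symm ▸ Subtype.prop (p := IsRational) (e.hom.f.toFun x)
  · let r : {t : LambdaTree V // t.IsRational} := ⟨t.1, ht⟩
    refine ⟨e.inv.f.toFun r, Subtype.ext ((hval _).trans ?_)⟩
    exact congrArg Subtype.val (hinv' r)

theorem mainTheorem3 (V : Type u) [Countable V] [Infinite V] :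
    IsRationalFixpoint (lamFunctor V) (rationalCoalgebra V) ∧
    Nonempty (IsTerminal (finVarsCoalgebra V)) ∧
    ∀ R : Endofunctor.Coalgebra (lamFunctor V), IsRationalFixpoint (lamFunctor V) R →
      ∀ i : R ⟶ finVarsCoalgebra V,
        Function.Injective i.f.toFun ∧
        ∀ t : {t : LambdaTree V // t.HasFiniteVars},
          (∃ x : R.V.carrier, i.f.toFun x = t) ↔ t.1.IsRational := by
  refine ⟨isRationalFixpoint_rationalCoalgebra, ⟨finVarsIsTerminal⟩, fun R hR i => ?_⟩
  obtain ⟨e⟩ := hR.nonempty_iso isRationalFixpoint_rationalCoalgebra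
  exact hom_finVarsCoalgebra_of_iso e i
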